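/- Let $F$ be a field, $\overline F$ an algebraic closure of $F$, $n,m\ge 0$ integers, $A$ an $n\times n$ matrix over $F$, and $q\in F[x]$ monic of degree $n$. For $p\in F[x]$ and $\lambda\in\overline F$ let $m_\lambda(p)$ be the multiplicity of $\lambda$ as a zero of $p$ (with $m_\lambda(p)=0$ if $\lambda$ is not a zero of $p$), and let $\operatorname{alg}_\lambda(A)=m_\lambda(p_A)$, where $p_A$ denotes the characteristic polynomial of $A$. Then $A$ has a Jordan form over $\overline F$. Moreover, for any Jordan form of $A$ over $\overline F$, let $k_{\lambda,1}\ge k_{\lambda,2}\ge\cdots$ be the sizes of its Jordan blocks for $\lambda$ in decreasing order, continued by zeros. Then there exists an $n\times n$ matrix $B$ over $F$ of rank $\le m$ with $p_{A+B}=q$ if and only if for every eigenvalue $\lambda\in\overline F$ of $A$ $$m_\lambda(q)\ \ge\ \operatorname{alg}_\lambda(A)-\sum_{j=1}^m k_{\lambda,j}.$$ -/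

import Mathlib

open Polynomial

noncomputable section

/-- The multiplicity `m_a(p)` of `a`, an element of an extension field `K` of `F`, as a zero of
`p ∈ F[X]`; it is `0` if `a` is not a zero of `p`. -/
def zeroMultiplicity {F : Type*} [Field F] {K : Type*} [Field K] [Algebra F K]
    (a : K) (p : F[X]) : ℕ :=
  (p.map (algebraMap F K)).rootMultiplicity a

/-- The algebraic multiplicity of `a` as an eigenvalue of `A`: its multiplicity as a zero of the
characteristic polynomial of `A`. -/
def algMultiplicity {F : Type*} [Field F] {K : Type*} [Field K] [Algebra F K] {n : ℕ}
    (a : K) (A : Matrix (Fin n) (Fin n) F) : ℕ :=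
  zeroMultiplicity a A.charpoly

/-- `a : K` is an eigenvalue of the matrix `A`, regarded as a matrix over `K`. -/
def IsEigenvalueOf {F : Type*} [Field F] {K : Type*} [Field K] [Algebra F K] {n : ℕ}
    (a : K) (A : Matrix (Fin n) (Fin n) F) : Prop :=
  Module.End.HasEigenvalue (Matrix.toLin' (A.map (algebraMap F K))) a

/-- The `k × k` Jordan block with `a` on the diagonal and `1` on the superdiagonal. -/
def jordanBlock {K : Type*} [Field K] (a : K) (k : ℕ) : Matrix (Fin k) (Fin k) K :=
  Matrix.of fun i j => if i = j then a else if (i : ℕ) + 1 = (j : ℕ) then 1 else 0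

/-- A finite sequence of (nonempty) Jordan blocks over `K`, each given by its diagonal entry and
its size. -/
structure JordanBlocks (K : Type*) where
  /-- the number of blocks -/
  num : ℕ
  /-- the diagonal entry of each block -/
  entry : Fin num → K
  /-- the size of each block -/
  size : Fin num → ℕ
  size_pos : ∀ i, 0 < size i

namespace JordanBlocks

/-- The block diagonal matrix formed by the blocks. -/
def toMatrix {K : Type*} [Field K] (J : JordanBlocks K) :
    Matrix ((i : Fin J.num) × Fin (J.size i)) ((i : Fin J.num) × Fin (J.size i)) K :=
  Matrix.blockDiagonal' fun i => jordanBlock (J.entry i) (J.size i)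

/-- `J` is a Jordan form over `K` of the matrix `A`: up to a numbering of its rows and columns, the
block diagonal matrix of `J` is similar to `A` over `K`. -/
def IsJordanFormOf {F : Type*} [Field F] {K : Type*} [Field K] [Algebra F K] {n : ℕ}
    (J : JordanBlocks K) (A : Matrix (Fin n) (Fin n) F) : Prop :=
  ∃ e : ((i : Fin J.num) × Fin (J.size i)) ≃ Fin n, ∃ P : GL (Fin n) K,
    (P⁻¹).val * A.map (algebraMap F K) * P.val = Matrix.reindex e e J.toMatrix

open Classical in
/-- The multiset of the sizes of the blocks with diagonal entry `a`. -/
def sizes {K : Type*} (J : JordanBlocks K) (a : K) : Multiset ℕ :=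
  (Finset.univ.filter fun i => J.entry i = a).val.map J.size

/-- The size `k_{a,j+1}` of the `(j+1)`-st largest block with diagonal entry `a` (so `j = 0` is the
largest one), and `0` if there are at most `j` such blocks. -/
def nthSize {K : Type*} (J : JordanBlocks K) (a : K) (j : ℕ) : ℕ :=
  ((J.sizes a).sort (· ≥ ·)).getD j 0

end JordanBlocks

end

open Polynomial
noncomputable section

/-! ### Nullities of powers under a perturbation of bounded rank. -/

namespace LinearMap

variable {k V : Type*} [Field k] [AddCommGroup V] [Module k V]

/-! Everything about `A` at `a` is read off from the nullities `ν t` of `(A - a) ^ t` over `K`: `ν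
n` is the algebraic multiplicity, and `ν (t + 1) - ν t` is the number of Jordan blocks for `a` of
size greater than `t`. Counting level by level, the sum of the `m` largest blocks is the sum over `t
< n` of `min m (ν (t + 1) - ν t)` (`JordanBlocks.sum_nthSize`). This holds for every Jordan form, so
its choice is immaterial.

Necessity is then an inequality of linear algebra, `LinearMap.finrank_ker_pow_le_add`: adding an
operator of rank at most `m` to `N = A - a` lowers the nullity of `N ^ n` by at most that sum.

For sufficiency, split `F ^ n` over `F` itself into primary cyclic modules `F[X] / (p i ^ e i)`. For
each prime keep its `m` largest exponents, and use the Chinese remainder theorem to merge the kept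
pieces, one per prime, into `m` cyclic modules (`IsCyclicSum.prod_fiber`). Let `H` be the product of
the remaining `p i ^ e i`. The hypothesis on multiplicities says exactly enough to give `H ∣ q`, say
`q = r * H`. On the sum of the `m` cyclic modules, the block companion matrix and the single
companion matrix of `r` differ in at most `m` columns, so a perturbation of rank at most `m`
produces the characteristic polynomial `r` there and leaves `H` untouched
(`IsCyclicSum.exists_charpoly_add_eq_mul`). -/

theorem finrank_map_add_finrank_ker_inf [FiniteDimensional k V] (N : V →ₗ[k] V) (Z : Submodule k V) :
    Module.finrank k (Z.map N) + Module.finrank k (LinearMap.ker N ⊓ Z : Submodule k V) =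
      Module.finrank k Z := by
  have h := LinearMap.finrank_range_add_finrank_ker (N.domRestrict Z)
  rw [LinearMap.range_domRestrict] at h
  rw [← h]
  congr 1
  have : (LinearMap.ker N ⊓ Z : Submodule k V) = (LinearMap.ker (N.domRestrict Z)).map Z.subtype := by
    ext x
    simp [and_comm]
  rw [this]
  exact (Submodule.equivMapOfInjective _ Z.subtype_injective _).symm.finrank_eq

/-- The subspaces `N ^ j V + ∑ i < j, N ^ i (range B)`. -/
def perturbedRange (N B : V →ₗ[k] V) : ℕ → Submodule k V
  | 0 => ⊤
  | j + 1 => (perturbedRange N B j).map N ⊔ LinearMap.range B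

theorem perturbedRange_succ_le (N B : V →ₗ[k] V) (j : ℕ) :
    perturbedRange N B (j + 1) ≤ perturbedRange N B j := by
  induction j with
  | zero => exact le_top
  | succ j ih => exact sup_le_sup_right (Submodule.map_mono ih) _

theorem range_add_pow_le_perturbedRange (N B : V →ₗ[k] V) (j : ℕ) :
    LinearMap.range ((N + B) ^ j) ≤ perturbedRange N B j := by
  induction j with
  | zero => exact le_top
  | succ j ih =>
    rintro _ ⟨v, rfl⟩
    rw [pow_succ', Module.End.mul_apply, LinearMap.add_apply]
    exact Submodule.add_mem_sup (Submodule.mem_map_of_mem (ih ⟨v, rfl⟩)) ⟨_, rfl⟩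

/-- The extra power `N ^ i` lets the induction close: lowering `j` by one raises `i` by one. Each
step loses at most `m`, and also at most the dimension of `ker N ⊓ range (N ^ i)`, hence the
minimum. -/
theorem finrank_map_pow_perturbedRange_le [FiniteDimensional k V] (N B : V →ₗ[k] V) {m : ℕ}
    (hB : Module.finrank k (LinearMap.range B) ≤ m) (j i : ℕ) :
    Module.finrank k ((perturbedRange N B j).map (N ^ i)) ≤
      Module.finrank k (LinearMap.range (N ^ (i + j))) + ∑ t ∈ Finset.range j,
        min m (Module.finrank k (LinearMap.range (N ^ (i + t))) -
          Module.finrank k (LinearMap.range (N ^ (i + t + 1)))) := by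
  induction j generalizing i with
  | zero =>
    rw [LinearMap.range_eq_map]
    exact Nat.le_add_right _ _
  | succ j ih =>
    set Z := (perturbedRange N B (j + 1)).map (N ^ i) with hZ
    set Z' := (perturbedRange N B j).map (N ^ (i + 1)) with hZ'
    have e1 : Z = Z' ⊔ (LinearMap.range B).map (N ^ i) := by
      rw [hZ, hZ', perturbedRange, Submodule.map_sup, pow_succ, Module.End.mul_eq_comp,
        Submodule.map_comp]
    have h1 : Module.finrank k Z ≤ Module.finrank k Z' + m := by
      rw [e1]
      exact (Submodule.finrank_add_le_finrank_add_finrank _ _).trans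
        (Nat.add_le_add_left ((Submodule.finrank_map_le _ _).trans hB) _)
    -- This is where the subspaces being decreasing in `j` enters; with rank-nullity for `N` on `Z`
    -- it bounds `dim Z - dim Z'` by the dimension of `ker N ⊓ Z`.
    have h2 : Z.map N ≤ Z' := by
      rw [hZ, hZ', ← Submodule.map_comp, ← Module.End.mul_eq_comp, ← pow_succ']
      exact Submodule.map_mono (perturbedRange_succ_le N B j)
    have h3 := finrank_map_add_finrank_ker_inf N Z
    have h4 := finrank_map_add_finrank_ker_inf N (LinearMap.range (N ^ i))
    rw [← LinearMap.range_comp, ← Module.End.mul_eq_comp, ← pow_succ'] at h4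
    have h5 : Module.finrank k (LinearMap.ker N ⊓ Z : Submodule k V) ≤
        Module.finrank k (LinearMap.ker N ⊓ LinearMap.range (N ^ i) : Submodule k V) :=
      Submodule.finrank_mono (inf_le_inf_left _ (LinearMap.map_le_range))
    have h6 := Submodule.finrank_mono h2
    have h7 : Module.finrank k Z' ≤ _ := ih (i + 1)
    rw [Finset.sum_range_succ']
    have e2 : ∀ t, i + 1 + t = i + (t + 1) := fun t => by omega
    obtain ⟨r, hr⟩ : ∃ r : ℕ → ℕ, ∀ t, Module.finrank k (LinearMap.range (N ^ t)) = r t :=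
      ⟨_, fun _ => rfl⟩
    have h8 : Module.finrank k Z ≤ Module.finrank k Z' +
        min m (Module.finrank k (LinearMap.range (N ^ i)) -
          Module.finrank k (LinearMap.range (N ^ (i + 1)))) := by
      omega
    simp only [hr] at h7 h8 ⊢
    simp only [e2] at h7
    simp only [Nat.add_zero, ← Nat.add_assoc] at h7 ⊢
    omega

theorem finrank_range_add_pow_le [FiniteDimensional k V] (N B : V →ₗ[k] V) {m : ℕ}
    (hB : Module.finrank k (LinearMap.range B) ≤ m) (n : ℕ) :
    Module.finrank k (LinearMap.range ((N + B) ^ n)) ≤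
      Module.finrank k (LinearMap.range (N ^ n)) + ∑ t ∈ Finset.range n,
        min m (Module.finrank k (LinearMap.range (N ^ t)) -
          Module.finrank k (LinearMap.range (N ^ (t + 1)))) := by
  have h := finrank_map_pow_perturbedRange_le N B hB n 0
  rw [pow_zero, show (1 : V →ₗ[k] V) = LinearMap.id from rfl, Submodule.map_id] at h
  obtain ⟨r, hr⟩ : ∃ r : ℕ → ℕ, ∀ t, Module.finrank k (LinearMap.range (N ^ t)) = r t :=
    ⟨_, fun _ => rfl⟩
  simp only [hr] at h ⊢
  simp only [Nat.zero_add] at h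
  exact (Submodule.finrank_mono (range_add_pow_le_perturbedRange N B n)).trans h

/-- The kernel version of `finrank_range_add_pow_le`. -/
theorem finrank_ker_pow_le_add [FiniteDimensional k V] (N B : V →ₗ[k] V) {m : ℕ}
    (hB : Module.finrank k (LinearMap.range B) ≤ m) (n : ℕ) :
    Module.finrank k (LinearMap.ker (N ^ n)) ≤
      Module.finrank k (LinearMap.ker ((N + B) ^ n)) + ∑ t ∈ Finset.range n,
        min m (Module.finrank k (LinearMap.ker (N ^ (t + 1))) -
          Module.finrank k (LinearMap.ker (N ^ t))) := by
  have h := finrank_range_add_pow_le N B hB n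
  have r (M : V →ₗ[k] V) := LinearMap.finrank_range_add_finrank_ker M
  have e : ∀ t, Module.finrank k (LinearMap.range (N ^ t)) -
          Module.finrank k (LinearMap.range (N ^ (t + 1))) =
      Module.finrank k (LinearMap.ker (N ^ (t + 1))) -
          Module.finrank k (LinearMap.ker (N ^ t)) := fun t => by
    have := r (N ^ t)
    have := r (N ^ (t + 1))
    omega
  simp only [e] at h
  have := r (N ^ n)
  have := r ((N + B) ^ n)
  omega

end LinearMap

/-! ### Sums of largest elements and the conjugate partition. -/

theorem List.lt_getD_iff_lt_countP {l : List ℕ} (hl : l.Pairwise (· ≥ ·)) (t j : ℕ) :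
    t < l.getD j 0 ↔ j < l.countP (t < ·) := by
  induction l generalizing j with
  | nil => simp
  | cons x l ih =>
    rw [List.pairwise_cons] at hl
    rw [List.countP_cons]
    by_cases hx : t < x
    · cases j with
      | zero => simp [hx]
      | succ j => simp only [List.getD_cons_succ, ih hl.2, hx]; simp
    -- The list is decreasing, so a head that fails `t < x` forces the whole tail to fail; the
    -- default `0` never exceeds `t` either.
    · have h0 : l.countP (t < ·) = 0 := by
        rw [List.countP_eq_zero]
        intro y hy
        have := hl.1 y hy
        simp only [decide_eq_true_eq]
        omega
      rw [h0]
      cases j with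
      | zero => simp [hx]
      | succ j =>
        have := (ih hl.2 j)
        rw [h0] at this
        simp only [List.getD_cons_succ, this, hx]
        simp

/-- The sum of the `m` largest elements, counted level by level. -/
theorem Multiset.sum_range_sort_getD (s : Multiset ℕ) {n : ℕ} (hs : ∀ x ∈ s, x ≤ n) (m : ℕ) :
    ∑ j ∈ Finset.range m, (s.sort (· ≥ ·)).getD j 0 =
      ∑ t ∈ Finset.range n, min m (s.countP (t < ·)) := by
  have h1 : ∀ j, (s.sort (· ≥ ·)).getD j 0 =
      ∑ t ∈ Finset.range n, if t < (s.sort (· ≥ ·)).getD j 0 then 1 else 0 := by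
    intro j
    rw [← Finset.card_filter]
    have h2 : (s.sort (· ≥ ·)).getD j 0 ≤ n := by
      rw [List.getD_eq_getElem?_getD]
      by_cases hj : j < (s.sort (· ≥ ·)).length
      · rw [List.getElem?_eq_getElem hj]
        exact hs _ ((Multiset.mem_sort _).1 (List.getElem_mem hj))
      · simp [List.getElem?_eq_none (not_lt.1 hj)]
    conv_lhs => rw [← Finset.card_range ((s.sort (· ≥ ·)).getD j 0)]
    congr 1
    ext t
    simp only [Finset.mem_range, Finset.mem_filter]
    omega
  rw [Finset.sum_congr rfl fun j _ => h1 j, Finset.sum_comm]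
  refine Finset.sum_congr rfl fun t _ => ?_
  have h3 : s.countP (t < ·) = (s.sort (· ≥ ·)).countP (t < ·) := by
    conv_lhs => rw [← Multiset.sort_eq s (· ≥ ·)]
    exact Multiset.coe_countP _ _
  rw [← Finset.card_filter, h3]
  simp only [List.lt_getD_iff_lt_countP (Multiset.pairwise_sort s (· ≥ ·))]
  generalize List.countP _ _ = c
  rw [show (Finset.range m).filter (· < c) = Finset.range (min m c) by ext; simp]
  exact Finset.card_range _

/-! ### Matrices and kernels on a cyclic module. -/

section AdjoinRootBases

variable {k : Type*} [Field k]

/-- The `d × d` companion matrix of a monic polynomial of degree `d`. -/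
def companionMatrix (d : ℕ) (f : k[X]) : Matrix (Fin d) (Fin d) k :=
  Matrix.of fun i j => if (j : ℕ) + 1 = d then -f.coeff i else if (i : ℕ) = j + 1 then 1 else 0

theorem companionMatrix_map {K : Type*} [Field K] (φ : k →+* K) (d : ℕ) (f : k[X]) :
    (companionMatrix d f).map φ = companionMatrix d (f.map φ) := by
  ext i j
  simp only [companionMatrix, Matrix.map_apply, Matrix.of_apply, coeff_map]
  split_ifs <;> simp

theorem AdjoinRoot.exists_basis_toMatrix_companionMatrix {f : k[X]} (hf : f.Monic) {d : ℕ}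
    (hd : f.natDegree = d) :
    ∃ b : Module.Basis (Fin d) k (AdjoinRoot f),
      LinearMap.toMatrix b b (Algebra.lmul k _ (AdjoinRoot.root f)) = companionMatrix d f := by
  subst hd
  refine ⟨(AdjoinRoot.powerBasis' hf).basis, ?_⟩
  have h := (AdjoinRoot.powerBasis' hf).leftMulMatrix
  have h2 : (AdjoinRoot.powerBasis' hf).minpolyGen = f := by
    rw [PowerBasis.minpolyGen_eq, AdjoinRoot.powerBasis'_gen, AdjoinRoot.minpoly_root hf.ne_zero,
      hf.leadingCoeff]
    simp
  rw [h2] at h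
  exact h

theorem charpoly_companionMatrix {f : k[X]} (hf : f.Monic) {d : ℕ} (hd : f.natDegree = d) :
    (companionMatrix d f).charpoly = f := by
  subst hd
  have h := (AdjoinRoot.powerBasis' hf).leftMulMatrix
  have h3 := charpoly_leftMulMatrix (AdjoinRoot.powerBasis' hf)
  have h2 : minpoly k (AdjoinRoot.powerBasis' hf).gen = f := by
    rw [AdjoinRoot.powerBasis'_gen, AdjoinRoot.minpoly_root hf.ne_zero, hf.leadingCoeff]
    simp
  rw [PowerBasis.minpolyGen_eq, h2] at h
  rw [h, h2] at h3
  exact h3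

theorem AdjoinRoot.finrank_eq_natDegree {f : k[X]} (hf : f.Monic) :
    Module.finrank k (AdjoinRoot f) = f.natDegree := by
  rw [(AdjoinRoot.powerBasis' hf).finrank, AdjoinRoot.powerBasis'_dim]

/-- The basis consists of the powers of `y = root - a` in descending order, `y ^ (d - 1), ..., 1`,
since the ones of `jordanBlock` lie above the diagonal. -/
theorem AdjoinRoot.exists_basis_toMatrix_jordanBlock (a : k) (d : ℕ) :
    ∃ b : Module.Basis (Fin d) k (AdjoinRoot ((X - C a) ^ d)),
      LinearMap.toMatrix b b (Algebra.lmul k _ (AdjoinRoot.root ((X - C a) ^ d))) =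
        jordanBlock a d := by
  set f := (X - C a) ^ d with hf
  have hm : f.Monic := (monic_X_sub_C a).pow d
  have hd : f.natDegree = d := by rw [hf, natDegree_pow, natDegree_X_sub_C, mul_one]
  set y : AdjoinRoot f := AdjoinRoot.root f - algebraMap k _ a with hy
  have hmin : minpoly k y = X ^ d := by
    rw [hy, minpoly.sub_algebraMap, AdjoinRoot.minpoly_root hm.ne_zero, hm.leadingCoeff, hf]
    simp
  have hy0 : y ^ d = 0 := by
    have := minpoly.aeval k y
    rwa [hmin, aeval_X_pow] at this
  have hli : LinearIndependent k fun i : Fin d => y ^ (i : ℕ) := by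
    have h := linearIndependent_pow (K := k) y
    have e : (minpoly k y).natDegree = d := by rw [hmin, natDegree_X_pow]
    rw [e] at h
    exact h
  have hcard : Fintype.card (Fin d) = Module.finrank k (AdjoinRoot f) := by
    rw [AdjoinRoot.finrank_eq_natDegree hm, hd, Fintype.card_fin]
  have : Module.Finite k (AdjoinRoot f) := hm.finite_adjoinRoot
  let c := (basisOfLinearIndependentOfCardEqFinrank' _ hli hcard).reindex Fin.revPerm
  have hc : ∀ i, c i = y ^ (d - (i + 1 : ℕ)) := fun i => by simp [c]
  refine ⟨c, ?_⟩
  rw [← LinearEquiv.eq_symm_apply, LinearMap.toMatrix_symm]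
  refine c.ext fun j => ?_
  rw [Matrix.toLin_self]
  have hr : AdjoinRoot.root f = y + algebraMap k _ a := by rw [hy]; ring
  have hl : Algebra.lmul k (AdjoinRoot f) (AdjoinRoot.root f) (c j) =
      a • c j + y * c j := by
    rw [Algebra.coe_lmul_eq_mul, LinearMap.mul_apply', hr, add_mul, Algebra.smul_def, add_comm]
  rw [hl]
  have hs : ∀ i : Fin d, jordanBlock a d i j • c i =
      (if i = j then a • c i else 0) + if (i : ℕ) + 1 = j then c i else 0 := fun i => by
    simp only [jordanBlock, Matrix.of_apply]
    by_cases h1 : i = j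
    · subst h1; simp
    · simp only [h1, if_false, zero_add]
      split_ifs <;> simp
  rw [Finset.sum_congr rfl fun i _ => hs i, Finset.sum_add_distrib, Finset.sum_ite_eq' _ j]
  simp only [Finset.mem_univ, if_true]
  congr 1
  rw [hc, ← pow_succ']
  have hjd := j.2
  by_cases hj : (j : ℕ) = 0
  · rw [Finset.sum_eq_zero fun i _ => if_neg (by omega), hj]
    rw [show d - (0 + 1) + 1 = d by omega, hy0]
  · rw [Finset.sum_eq_single (⟨j - 1, by omega⟩ : Fin d)]
    · rw [if_pos (by simp only; omega), hc]
      congr 1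
      simp only
      omega
    · intro i _ hi
      rw [if_neg]
      intro h
      apply hi
      ext
      simp only
      omega
    · simp

/-- On `k[X] / (f)`, the kernel of multiplication by `g` has dimension `deg (gcd f g)`. -/
theorem AdjoinRoot.finrank_ker_lmul_mk {f g : k[X]} (hf : f ≠ 0) {h : k[X]}
    (hd : Ideal.span {f} ⊔ Ideal.span {g} = Ideal.span {h}) :
    Module.finrank k (LinearMap.ker (Algebra.lmul k (AdjoinRoot f) (AdjoinRoot.mk f g))) =
      h.natDegree := by
  have : Module.Finite k (AdjoinRoot f) := (AdjoinRoot.powerBasis hf).finite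
  set M := Algebra.lmul k (AdjoinRoot f) (AdjoinRoot.mk f g) with hM
  have h1 := LinearMap.finrank_range_add_finrank_ker M
  have h2 := (LinearMap.range M).finrank_quotient_add_finrank
  have hh : h ∣ f := by
    rw [← Ideal.mem_span_singleton, ← hd]
    exact Ideal.mem_sup_left (Ideal.mem_span_singleton_self f)
  have hg : h ∣ g := by
    rw [← Ideal.mem_span_singleton, ← hd]
    exact Ideal.mem_sup_right (Ideal.mem_span_singleton_self g)
  have hh0 : h ≠ 0 := ne_zero_of_dvd_ne_zero hf hh
  -- The image of multiplication by `g` is `(f, g) / (f) = (h) / (f)`, with quotient `k[X] / (h)`;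
  -- rank-nullity makes the kernel as large as this quotient.
  have hker : LinearMap.range M = LinearMap.ker (AdjoinRoot.algHomOfDvd k f h hh).toLinearMap := by
    ext x
    obtain ⟨p, rfl⟩ := AdjoinRoot.mk_surjective x
    have e : (AdjoinRoot.algHomOfDvd k f h hh) (AdjoinRoot.mk f p) = AdjoinRoot.mk h p := by
      rw [← AdjoinRoot.aeval_eq, ← aeval_algHom_apply, AdjoinRoot.algHomOfDvd_root,
        AdjoinRoot.aeval_eq]
    rw [LinearMap.mem_ker, AlgHom.toLinearMap_apply, e, AdjoinRoot.mk_eq_zero,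
      ← Ideal.mem_span_singleton, ← hd, Ideal.mem_span_singleton_sup]
    constructor
    · rintro ⟨y, hy⟩
      obtain ⟨q, rfl⟩ := AdjoinRoot.mk_surjective y
      rw [hM, Algebra.coe_lmul_eq_mul, LinearMap.mul_apply', ← map_mul, AdjoinRoot.mk_eq_mk] at hy
      obtain ⟨c, hc⟩ := hy
      refine ⟨-c, g * q, Ideal.mem_span_singleton.2 ⟨q, rfl⟩, ?_⟩
      linear_combination hc
    · rintro ⟨a, b, hb, hp⟩
      obtain ⟨q, rfl⟩ := Ideal.mem_span_singleton.1 hb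
      refine ⟨AdjoinRoot.mk f q, ?_⟩
      rw [hM, Algebra.coe_lmul_eq_mul, LinearMap.mul_apply', ← map_mul, AdjoinRoot.mk_eq_mk]
      exact ⟨-a, by linear_combination hp⟩
  have hsurj : Function.Surjective (AdjoinRoot.algHomOfDvd k f h hh).toLinearMap := by
    intro x
    obtain ⟨p, rfl⟩ := AdjoinRoot.mk_surjective x
    refine ⟨AdjoinRoot.mk f p, ?_⟩
    rw [AlgHom.toLinearMap_apply, ← AdjoinRoot.aeval_eq, ← aeval_algHom_apply,
      AdjoinRoot.algHomOfDvd_root, AdjoinRoot.aeval_eq]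
  have h4 := ((AdjoinRoot.algHomOfDvd k f h hh).toLinearMap.quotKerEquivOfSurjective
    hsurj).finrank_eq
  rw [← hker, (AdjoinRoot.powerBasis hh0).finrank, AdjoinRoot.powerBasis_dim] at h4
  omega

theorem AdjoinRoot.finrank_ker_lmul_root_sub_pow {f : k[X]} (hf : f ≠ 0) (a : k) (t : ℕ) :
    Module.finrank k (LinearMap.ker
      ((Algebra.lmul k (AdjoinRoot f) (AdjoinRoot.root f) - algebraMap k _ a) ^ t)) =
      min t (f.rootMultiplicity a) := by
  have e : (Algebra.lmul k (AdjoinRoot f) (AdjoinRoot.root f) - algebraMap k _ a) ^ t =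
      Algebra.lmul k (AdjoinRoot f) (AdjoinRoot.mk f ((X - C a) ^ t)) := by
    rw [map_pow, map_pow, map_sub, map_sub, AdjoinRoot.mk_X, AdjoinRoot.mk_C,
      ← AdjoinRoot.algebraMap_eq, AlgHom.commutes]
  obtain ⟨u, hu, hcop⟩ := exists_eq_pow_rootMultiplicity_mul_and_not_dvd f hf a
  set s := f.rootMultiplicity a with hs
  -- A Bézout relation here, multiplied by `(X - C a) ^ s`, puts that power in the ideal of `f` and
  -- `(X - C a) ^ t` when `s ≤ t`.
  have hcop' : IsCoprime u ((X - C a) ^ (t - s)) :=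
    (((irreducible_X_sub_C a).coprime_iff_not_dvd).2 hcop).symm.pow_right
  rw [e, AdjoinRoot.finrank_ker_lmul_mk hf (h := (X - C a) ^ (min t s)), natDegree_pow,
    natDegree_X_sub_C, mul_one]
  apply le_antisymm
  · rw [sup_le_iff, Ideal.span_singleton_le_span_singleton, Ideal.span_singleton_le_span_singleton]
    exact ⟨(pow_dvd_pow _ (min_le_right _ _)).trans ⟨u, hu⟩, pow_dvd_pow _ (min_le_left _ _)⟩
  · rw [Ideal.span_singleton_le_iff_mem]
    rcases le_total t s with h | h
    · rw [min_eq_left h]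
      exact Ideal.mem_sup_right (Ideal.mem_span_singleton_self _)
    · rw [min_eq_right h]
      obtain ⟨p, q, hpq⟩ := hcop'
      have h2 : (X - C a) ^ t = (X - C a) ^ s * (X - C a) ^ (t - s) := by
        rw [← pow_add]; congr 1; omega
      have : (X - C a) ^ s = p * f + q * (X - C a) ^ t := by
        rw [h2]
        nth_rewrite 1 [hu]
        linear_combination (-(X - C a) ^ s) * hpq
      rw [this]
      exact Ideal.add_mem _
        (Ideal.mem_sup_left (Ideal.mul_mem_left _ _ (Ideal.mem_span_singleton_self _)))
        (Ideal.mem_sup_right (Ideal.mul_mem_left _ _ (Ideal.mem_span_singleton_self _)))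

end AdjoinRootBases

/-! ### Direct sums of cyclic modules. -/

section CyclicSum

variable {k V ι : Type*} [Field k] [AddCommGroup V] [Module k V]

/-- `V` with the action of `T` is isomorphic to the direct sum of the cyclic `k[X]`-modules
`k[X] / (f i)`. -/
def IsCyclicSum (T : Module.End k V) (f : ι → k[X]) : Prop :=
  ∃ e : V ≃ₗ[k] (∀ i, AdjoinRoot (f i)), ∀ v i, e (T v) i = AdjoinRoot.root (f i) * e v i

theorem IsCyclicSum.reindex {ι' : Type*} {T : Module.End k V} {f : ι → k[X]}
    (h : IsCyclicSum T f) (σ : ι' ≃ ι) : IsCyclicSum T (fun i => f (σ i)) := by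
  obtain ⟨e, he⟩ := h
  exact ⟨e.trans (LinearEquiv.piCongrLeft k (fun i => AdjoinRoot (f i)) σ).symm,
    fun v i => he v (σ i)⟩

/-- This is the structure theorem for torsion `k[X]`-modules. Monic primes make associated primes
equal; ordering by exponent makes the first `m` occurrences of a prime the ones with largest
exponents. -/
theorem exists_isCyclicSum_irreducible_pow [FiniteDimensional k V] (T : Module.End k V) :
    ∃ (N : ℕ) (p : Fin N → k[X]) (e : Fin N → ℕ), (∀ i, (p i).Monic) ∧ (∀ i, Irreducible (p i)) ∧
      Antitone e ∧ IsCyclicSum T (fun i => p i ^ e i) := by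
  classical
  have htor : Module.IsTorsion k[X] (Module.AEval' T) :=
    Module.AEval.isTorsion_of_finiteDimensional k V T
  obtain ⟨ι, _, p, hp, e, ⟨l⟩⟩ := Module.equiv_directSum_of_isTorsion htor
  set p' : ι → k[X] := fun i => normalize (p i) with hp'
  have hmon : ∀ i, (p' i).Monic := fun i => Polynomial.monic_normalize (hp i).ne_zero
  have hirr : ∀ i, Irreducible (p' i) := fun i =>
    (associated_normalize (p i)).irreducible (hp i)
  have hspan : ∀ i, Submodule.span k[X] {p i ^ e i} = Ideal.span {p' i ^ e i} := fun i =>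
    Ideal.span_singleton_eq_span_singleton.2 ((associated_normalize (p i)).pow_pow)
  let l2 : Module.AEval' T ≃ₗ[k[X]] ∀ i, k[X] ⧸ Ideal.span {p' i ^ e i} :=
    l.trans ((DirectSum.linearEquivFunOnFintype k[X] ι _).trans
      (LinearEquiv.piCongrRight fun i => Submodule.quotEquivOfEq _ _ (hspan i)))
  let l3 : V ≃ₗ[k] ∀ i, AdjoinRoot (p' i ^ e i) :=
    (Module.AEval'.of T).trans (l2.restrictScalars k)
  have h3 : IsCyclicSum T (fun i => p' i ^ e i) := by
    refine ⟨l3, fun v i => ?_⟩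
    have h1 : l2 (Module.AEval'.of T (T v)) = (X : k[X]) • l2 (Module.AEval'.of T v) := by
      rw [← map_smul, Module.AEval'.X_smul_of]
    have h2 := congrFun h1 i
    rw [Pi.smul_apply] at h2
    obtain ⟨q, hq⟩ := Ideal.Quotient.mk_surjective (l2 (Module.AEval'.of T v) i)
    change l2 (Module.AEval'.of T (T v)) i =
      (AdjoinRoot.root (p' i ^ e i) * (show AdjoinRoot (p' i ^ e i) from
        l2 (Module.AEval'.of T v) i))
    rw [h2, ← hq]
    rfl
  let σ := Fintype.equivFin ι
  let e0 : Fin (Fintype.card ι) → ℕ := fun i => e (σ.symm i)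
  let τ : Fin (Fintype.card ι) ≃ ι := (Fin.revPerm.trans (Tuple.sort e0)).trans σ.symm
  refine ⟨Fintype.card ι, fun i => p' (τ i), fun i => e (τ i), fun i => hmon _, fun i => hirr _,
    ?_, h3.reindex τ⟩
  intro i j hij
  exact Tuple.monotone_sort e0 (Fin.rev_le_rev.2 hij)

theorem IsCyclicSum.finrank_ker_sub_pow [Fintype ι] {T : Module.End k V} {f : ι → k[X]}
    (h : IsCyclicSum T f) (hf : ∀ i, f i ≠ 0) (a : k) (t : ℕ) :
    Module.finrank k (LinearMap.ker ((T - algebraMap k _ a) ^ t)) =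
      ∑ i, min t ((f i).rootMultiplicity a) := by
  obtain ⟨e, he⟩ := h
  let M := fun i => (Algebra.lmul k (AdjoinRoot (f i)) (AdjoinRoot.root (f i)) - algebraMap k _ a) ^ t
  have key : ∀ v i, e (((T - algebraMap k _ a) ^ t) v) i = M i (e v i) := by
    induction t with
    | zero => intro v i; rfl
    | succ t ih =>
      intro v i
      simp only [M] at ih ⊢
      rw [pow_succ, pow_succ, Module.End.mul_apply, Module.End.mul_apply, ih]
      congr 1
      simp [he]
  have hmem : ∀ v, v ∈ LinearMap.ker ((T - algebraMap k _ a) ^ t) ↔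
      ∀ i, e v i ∈ LinearMap.ker (M i) := fun v => by
    rw [LinearMap.mem_ker, ← e.map_eq_zero_iff, funext_iff]
    simp only [key, LinearMap.mem_ker, Pi.zero_apply]
  have : ∀ i, Module.Finite k (AdjoinRoot (f i)) := fun i => (AdjoinRoot.powerBasis (hf i)).finite
  let E : LinearMap.ker ((T - algebraMap k _ a) ^ t) ≃ₗ[k] ∀ i, LinearMap.ker (M i) :=
    { toFun := fun v i => ⟨e v i, (hmem v).1 v.2 i⟩
      map_add' := fun v w => by ext i; simp
      map_smul' := fun c v => by ext i; simp
      invFun := fun y => ⟨e.symm fun i => y i, (hmem _).2 fun i => by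
        rw [LinearEquiv.apply_symm_apply]; exact (y i).2⟩
      left_inv := fun v => by ext; simp
      right_inv := fun y => by ext i; simp }
  rw [E.finrank_eq, Module.finrank_pi_fintype]
  exact Finset.sum_congr rfl fun i _ => AdjoinRoot.finrank_ker_lmul_root_sub_pow (hf i) a t

/-- The difference of consecutive nullities counts the summands in which `a` has multiplicity
greater than `t`. -/
theorem IsCyclicSum.card_lt_rootMultiplicity [Fintype ι] {T : Module.End k V} {f : ι → k[X]}
    (h : IsCyclicSum T f) (hf : ∀ i, f i ≠ 0) (a : k) (t : ℕ) :
    Module.finrank k (LinearMap.ker ((T - algebraMap k _ a) ^ (t + 1))) -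
      Module.finrank k (LinearMap.ker ((T - algebraMap k _ a) ^ t)) =
      (Finset.univ.filter fun i => t < (f i).rootMultiplicity a).card := by
  rw [h.finrank_ker_sub_pow hf, h.finrank_ker_sub_pow hf, Finset.card_filter]
  apply Nat.sub_eq_of_eq_add
  rw [← Finset.sum_add_distrib]
  refine Finset.sum_congr rfl fun i _ => ?_
  split_ifs <;> omega

theorem IsCyclicSum.exists_basis [Fintype ι] [DecidableEq ι] {τ : ι → Type*} [∀ i, Fintype (τ i)]
    [∀ i, DecidableEq (τ i)] {T : Module.End k V} {f : ι → k[X]} (h : IsCyclicSum T f)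
    (b : ∀ i, Module.Basis (τ i) k (AdjoinRoot (f i))) :
    ∃ c : Module.Basis (Σ i, τ i) k V, LinearMap.toMatrix c c T = Matrix.blockDiagonal' fun i =>
      LinearMap.toMatrix (b i) (b i) (Algebra.lmul k _ (AdjoinRoot.root (f i))) := by
  obtain ⟨e, he⟩ := h
  refine ⟨(Pi.basis b).map e.symm, ?_⟩
  ext ⟨i, x⟩ ⟨j, y⟩
  rw [LinearMap.toMatrix_apply, Module.Basis.map_repr, Module.Basis.map_apply,
    LinearEquiv.symm_symm, LinearEquiv.trans_apply, Pi.basis_repr, he, LinearEquiv.apply_symm_apply,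
    Pi.basis_apply]
  by_cases hij : i = j
  · subst hij
    rw [Matrix.blockDiagonal'_apply_eq, LinearMap.toMatrix_apply]
    simp
  · rw [Matrix.blockDiagonal'_apply_ne _ _ _ hij]
    simp [Pi.single_eq_of_ne hij]

theorem isCyclicSum_of_basis [Fintype ι] [DecidableEq ι] {τ : ι → Type*} [∀ i, Fintype (τ i)]
    [∀ i, DecidableEq (τ i)] {T : Module.End k V} {f : ι → k[X]}
    (b : ∀ i, Module.Basis (τ i) k (AdjoinRoot (f i))) (c : Module.Basis (Σ i, τ i) k V)
    (h : LinearMap.toMatrix c c T = Matrix.blockDiagonal' fun i =>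
      LinearMap.toMatrix (b i) (b i) (Algebra.lmul k _ (AdjoinRoot.root (f i)))) :
    IsCyclicSum T f := by
  let S : Module.End k (∀ i, AdjoinRoot (f i)) :=
    LinearMap.pi fun i => (Algebra.lmul k _ (AdjoinRoot.root (f i))).comp (LinearMap.proj i)
  have hS : IsCyclicSum S f := ⟨LinearEquiv.refl k _, fun v i => rfl⟩
  let B := Pi.basis b
  have hB : LinearMap.toMatrix B B S = LinearMap.toMatrix c c T := by
    rw [h]
    ext ⟨i, x⟩ ⟨j, y⟩
    rw [LinearMap.toMatrix_apply, Pi.basis_repr, Pi.basis_apply]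
    by_cases hij : i = j
    · subst hij
      rw [Matrix.blockDiagonal'_apply_eq, LinearMap.toMatrix_apply]
      simp [S]
    · rw [Matrix.blockDiagonal'_apply_ne _ _ _ hij]
      simp [S, Pi.single_eq_of_ne hij]
  let e := c.equiv B (Equiv.refl _)
  have key : e.toLinearMap ∘ₗ T = S ∘ₗ e.toLinearMap := by
    refine c.ext fun j => ?_
    simp only [LinearMap.comp_apply, LinearEquiv.coe_coe, e, Module.Basis.equiv_apply,
      Equiv.refl_apply]
    have h1 : S (B j) = ∑ i, LinearMap.toMatrix B B S i j • B i := by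
      rw [← Matrix.toLin_self B B, Matrix.toLin_toMatrix]
    have h2 : T (c j) = ∑ i, LinearMap.toMatrix c c T i j • c i := by
      rw [← Matrix.toLin_self c c, Matrix.toLin_toMatrix]
    rw [h1, h2, hB, map_sum]
    refine Finset.sum_congr rfl fun i _ => ?_
    rw [map_smul, Module.Basis.equiv_apply, Equiv.refl_apply]
  refine ⟨e, fun v i => ?_⟩
  have := LinearMap.congr_fun key v
  exact congrFun this i

/-- Coprime cyclic summands can be merged. -/
theorem IsCyclicSum.prod_fiber {κ : Type*} [Fintype ι] [Fintype κ] [DecidableEq κ]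
    {T : Module.End k V} {f : ι → k[X]} (h : IsCyclicSum T f) (hf : ∀ i, (f i).Monic) (c : ι → κ)
    (hc : ∀ i j, i ≠ j → c i = c j → IsCoprime (f i) (f j)) :
    IsCyclicSum T (fun x : κ => ∏ i with c i = x, f i) := by
  obtain ⟨e, he⟩ := h
  set g : κ → k[X] := fun x => ∏ i with c i = x, f i with hg
  have hgm : ∀ x, (g x).Monic := fun x => monic_prod_of_monic _ _ fun i _ => hf i
  have hdvd : ∀ i, f i ∣ g (c i) := fun i => Finset.dvd_prod_of_mem _ (by simp)
  have : ∀ i, Module.Finite k (AdjoinRoot (f i)) := fun i => (hf i).finite_adjoinRoot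
  have : ∀ x, Module.Finite k (AdjoinRoot (g x)) := fun x => (hgm x).finite_adjoinRoot
  let Φ : (∀ x, AdjoinRoot (g x)) →ₗ[k] ∀ i, AdjoinRoot (f i) :=
    LinearMap.pi fun i => (AdjoinRoot.algHomOfDvd k (g (c i)) (f i) (hdvd i)).toLinearMap.comp
      (LinearMap.proj (c i))
  have hΦ : ∀ y i, Φ y i = AdjoinRoot.algHomOfDvd k (g (c i)) (f i) (hdvd i) (y (c i)) :=
    fun y i => rfl
  -- A polynomial divisible by pairwise coprime `f i` is divisible by their product; surjectivity
  -- then follows by comparing dimensions.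
  have hinj : Function.Injective Φ := by
    rw [injective_iff_map_eq_zero]
    intro y hy
    funext x
    obtain ⟨p, hp⟩ := AdjoinRoot.mk_surjective (y x)
    rw [← hp, Pi.zero_apply, AdjoinRoot.mk_eq_zero]
    apply Finset.prod_dvd_of_coprime
    · intro i hi j hj hij
      simp only [Finset.coe_filter, Finset.mem_univ, true_and, Set.mem_ofPred_eq] at hi hj
      exact hc i j hij (hi.trans hj.symm)
    · intro i hi
      simp only [Finset.mem_filter, Finset.mem_univ, true_and] at hi
      subst hi
      have h1 := congrFun hy i
      rwa [hΦ, ← hp, Pi.zero_apply, ← AdjoinRoot.aeval_eq, ← aeval_algHom_apply,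
        AdjoinRoot.algHomOfDvd_root, AdjoinRoot.aeval_eq, AdjoinRoot.mk_eq_zero] at h1
  have hfin : Module.finrank k (∀ x, AdjoinRoot (g x)) =
      Module.finrank k (∀ i, AdjoinRoot (f i)) := by
    rw [Module.finrank_pi_fintype, Module.finrank_pi_fintype,
      Finset.sum_congr rfl fun i _ => AdjoinRoot.finrank_eq_natDegree (hf i),
      Finset.sum_congr rfl fun x _ => AdjoinRoot.finrank_eq_natDegree (hgm x),
      ← Finset.sum_fiberwise _ c]
    exact Finset.sum_congr rfl fun x _ => natDegree_prod_of_monic _ _ fun i _ => hf i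
  let E := LinearEquiv.ofInjectiveOfFinrankEq Φ hinj hfin
  have hE : ∀ y, E y = Φ y := fun y => rfl
  refine ⟨e.trans E.symm, fun v => ?_⟩
  rw [← funext_iff (g := fun x => AdjoinRoot.root (g x) * (e.trans E.symm) v x)]
  rw [LinearEquiv.trans_apply, LinearEquiv.symm_apply_eq, hE]
  funext i
  rw [he, hΦ, map_mul, AdjoinRoot.algHomOfDvd_root, ← hΦ, LinearEquiv.trans_apply, ← hE,
    LinearEquiv.apply_symm_apply]

end CyclicSum

/-! ### Similarity of matrices and extension of scalars. -/

section Similarity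

variable {k : Type*} [Field k] {n : ℕ} {σ : Type*} [Fintype σ] [DecidableEq σ]

theorem exists_basis_toMatrix_eq_iff (A : Matrix (Fin n) (Fin n) k) (M : Matrix σ σ k) :
    (∃ c : Module.Basis σ k (Fin n → k), LinearMap.toMatrix c c (Matrix.toLin' A) = M) ↔
      ∃ (e : σ ≃ Fin n) (P : GL (Fin n) k), (P⁻¹).val * A * P.val = Matrix.reindex e e M := by
  constructor
  · rintro ⟨c, hc⟩
    have hcard : Fintype.card σ = Fintype.card (Fin n) := by
      rw [← Module.finrank_eq_card_basis c, Module.finrank_fin_fun, Fintype.card_fin]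
    let e : σ ≃ Fin n := Fintype.equivOfCardEq hcard
    let s := Pi.basisFun k (Fin n)
    let c' := c.reindex e
    refine ⟨e, ⟨s.toMatrix c', c'.toMatrix s, s.toMatrix_mul_toMatrix_flip c',
      c'.toMatrix_mul_toMatrix_flip s⟩, ?_⟩
    change c'.toMatrix s * A * s.toMatrix c' = _
    have h1 : A = LinearMap.toMatrix s s (Matrix.toLin' A) := by
      rw [LinearMap.toMatrix_eq_toMatrix', LinearMap.toMatrix'_toLin']
    rw [h1, basis_toMatrix_mul_linearMap_toMatrix_mul_basis_toMatrix, ← hc]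
    ext i j
    simp [LinearMap.toMatrix_apply, c']
  · rintro ⟨e, P, hP⟩
    let E : (Fin n → k) ≃ₗ[k] (Fin n → k) := Matrix.toLin'OfInv
      (M := (P⁻¹).val) (M' := P.val) (by rw [← Units.val_mul]; simp) (by rw [← Units.val_mul]; simp)
    have hE : ∀ v, E v = P.val.mulVec v := fun v => rfl
    have hE' : ∀ v, E.symm v = (P⁻¹).val.mulVec v := fun v => rfl
    refine ⟨((Pi.basisFun k (Fin n)).map E).reindex e.symm, ?_⟩
    ext i j
    rw [LinearMap.toMatrix_apply, Module.Basis.repr_reindex, Finsupp.mapDomain_equiv_apply,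
      Module.Basis.map_repr, LinearEquiv.trans_apply, Pi.basisFun_repr, Module.Basis.reindex_apply,
      Module.Basis.map_apply, Equiv.symm_symm, hE, hE', Matrix.toLin'_apply, Matrix.mulVec_mulVec,
      Matrix.mulVec_mulVec, hP, Pi.basisFun_apply, Matrix.mulVec_single_one]
    simp

/-- A cyclic decomposition amounts to similarity with a block matrix of companion matrices, and both
similarity and companion matrices are preserved by a field embedding. -/
theorem IsCyclicSum.map {F K : Type*} [Field F] [Field K] [Algebra F K] {ι : Type*} [Fintype ι]
    {A : Matrix (Fin n) (Fin n) F} {f : ι → F[X]} (h : IsCyclicSum (Matrix.toLin' A) f)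
    (hf : ∀ i, (f i).Monic) :
    IsCyclicSum (Matrix.toLin' (A.map (algebraMap F K))) fun i => (f i).map (algebraMap F K) := by
  classical
  choose b hb using fun i => AdjoinRoot.exists_basis_toMatrix_companionMatrix (hf i) rfl
  choose b' hb' using fun i => AdjoinRoot.exists_basis_toMatrix_companionMatrix
    ((hf i).map (algebraMap F K)) (natDegree_map (p := f i) (algebraMap F K))
  obtain ⟨e, P, hP⟩ := (exists_basis_toMatrix_eq_iff _ _).1 (h.exists_basis b)
  have h2 : ∃ (e : (Σ i, Fin (f i).natDegree) ≃ Fin n) (P : GL (Fin n) K),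
      (P⁻¹).val * A.map (algebraMap F K) * P.val = Matrix.reindex e e (Matrix.blockDiagonal' fun i =>
        LinearMap.toMatrix (b' i) (b' i) (Algebra.lmul K _ (AdjoinRoot.root _))) := by
    refine ⟨e, Matrix.GeneralLinearGroup.map (algebraMap F K) P, ?_⟩
    have h3 := congrArg (fun M => M.map (algebraMap F K)) hP
    simp only [Matrix.map_mul, hb] at h3
    rw [← map_inv]
    refine h3.trans ?_
    simp only [hb', ← companionMatrix_map]
    rw [Matrix.reindex_apply, Matrix.reindex_apply, ← Matrix.submatrix_map,
      Matrix.blockDiagonal'_map _ _ (map_zero _)]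
  obtain ⟨c, hc⟩ := (exists_basis_toMatrix_eq_iff _ _).2 h2
  exact isCyclicSum_of_basis b' c hc

end Similarity

/-! ### Jordan forms as cyclic decompositions. -/

namespace JordanBlocks

variable {F K : Type*} [Field F] [Field K] [Algebra F K] {n : ℕ}

theorem isJordanFormOf_iff_isCyclicSum (J : JordanBlocks K) (A : Matrix (Fin n) (Fin n) F) :
    J.IsJordanFormOf A ↔ IsCyclicSum (Matrix.toLin' (A.map (algebraMap F K)))
      fun i => (X - C (J.entry i)) ^ J.size i := by
  choose b hb using fun i => AdjoinRoot.exists_basis_toMatrix_jordanBlock (J.entry i) (J.size i)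
  have e : J.toMatrix = Matrix.blockDiagonal' fun i =>
      LinearMap.toMatrix (b i) (b i) (Algebra.lmul K _ (AdjoinRoot.root _)) := by
    simp only [hb]
    rfl
  rw [IsJordanFormOf, e, ← exists_basis_toMatrix_eq_iff]
  exact ⟨fun ⟨c, hc⟩ => isCyclicSum_of_basis b c hc, fun h => h.exists_basis b⟩

theorem exists_isJordanFormOf [IsAlgClosed K] (A : Matrix (Fin n) (Fin n) F) :
    ∃ J : JordanBlocks K, J.IsJordanFormOf A := by
  obtain ⟨N, p, e, hm, hirr, -, E, hE⟩ :=
    exists_isCyclicSum_irreducible_pow (Matrix.toLin' (A.map (algebraMap F K)))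
  have hp : ∀ i, ∃ a, p i = X - C a := fun i => by
    have h1 := IsAlgClosed.degree_eq_one_of_irreducible K (hirr i)
    refine ⟨-(p i).coeff 0, ?_⟩
    rw [C_neg, sub_neg_eq_add]
    exact (hm i).eq_X_add_C (natDegree_eq_of_degree_eq_some h1)
  choose a ha using hp
  let σ := Fintype.equivFin {i // 0 < e i}
  -- The decomposition may contain exponents `0`; those summands vanish and are dropped, as Jordan
  -- blocks must be nonempty.
  have hsub : ∀ i, ¬ 0 < e i → Subsingleton (AdjoinRoot (p i ^ e i)) := fun i hi => by
    rw [Nat.eq_zero_of_not_pos hi, pow_zero]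
    exact Ideal.Quotient.subsingleton_iff.2 (Ideal.span_singleton_one)
  let R : (∀ i, AdjoinRoot (p i ^ e i)) →ₗ[K] ∀ i : {i // 0 < e i}, AdjoinRoot (p i ^ e i) :=
    LinearMap.pi fun i => LinearMap.proj i.1
  have hR : Function.Bijective R := by
    constructor
    · intro y z hyz
      funext i
      by_cases hi : 0 < e i
      · exact congrFun hyz ⟨i, hi⟩
      · have := hsub i hi
        exact Subsingleton.elim _ _
    · intro y
      refine ⟨fun i => if hi : 0 < e i then y ⟨i, hi⟩ else 0, ?_⟩
      funext i
      exact dif_pos i.2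
  have h1 : IsCyclicSum (Matrix.toLin' (A.map (algebraMap F K)))
      fun i : {i // 0 < e i} => p i ^ e i :=
    ⟨E.trans (LinearEquiv.ofBijective R hR), fun v i => hE v i.1⟩
  refine ⟨⟨_, fun i => a (σ.symm i), fun i => e (σ.symm i), fun i => (σ.symm i).2⟩, ?_⟩
  rw [isJordanFormOf_iff_isCyclicSum]
  simp only [ha] at h1
  exact h1.reindex σ.symm

theorem rootMultiplicity_block (J : JordanBlocks K) [DecidableEq K] (a : K) (i : Fin J.num) :
    ((X - C (J.entry i)) ^ J.size i).rootMultiplicity a =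
      if J.entry i = a then J.size i else 0 := by
  split_ifs with h
  · rw [h, rootMultiplicity_X_sub_C_pow]
  · rw [rootMultiplicity_eq_zero]
    rw [IsRoot, eval_pow, eval_sub, eval_X, eval_C]
    exact pow_ne_zero _ (sub_ne_zero.2 (Ne.symm h))

theorem sum_nthSize {J : JordanBlocks K} {A : Matrix (Fin n) (Fin n) F} (h : J.IsJordanFormOf A)
    (a : K) (m : ℕ) :
    ∑ j ∈ Finset.range m, J.nthSize a j = ∑ t ∈ Finset.range n, min m
      (Module.finrank K (LinearMap.ker
        ((Matrix.toLin' (A.map (algebraMap F K)) - algebraMap K _ a) ^ (t + 1))) -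
      Module.finrank K (LinearMap.ker
        ((Matrix.toLin' (A.map (algebraMap F K)) - algebraMap K _ a) ^ t))) := by
  classical
  have hn : ∀ x ∈ J.sizes a, x ≤ n := by
    obtain ⟨e, -⟩ := h
    intro x hx
    obtain ⟨i, -, rfl⟩ := Multiset.mem_map.1 hx
    have h1 := Fintype.card_le_of_injective (fun y : Fin (J.size i) => e ⟨i, y⟩)
      (fun y z hyz => by simpa using hyz)
    simpa using h1
  have hc := (isJordanFormOf_iff_isCyclicSum J A).1 h
  refine (Multiset.sum_range_sort_getD (J.sizes a) hn m).trans ?_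
  refine Finset.sum_congr rfl fun t _ => ?_
  rw [hc.card_lt_rootMultiplicity fun i => ((monic_X_sub_C _).pow _).ne_zero]
  congr 1
  rw [sizes, Multiset.countP_map, ← Finset.filter_val, Finset.filter_filter, Finset.card_val]
  congr 1
  ext i
  simp only [Finset.mem_filter, Finset.mem_univ, true_and, rootMultiplicity_block]
  split_ifs with hi <;> simp [hi]

end JordanBlocks

/-! ### Prescribing the characteristic polynomial of a sum of cyclic modules. -/

theorem Matrix.charpoly_blockDiagonal' {R ι : Type*} [CommRing R] [Fintype ι] [LinearOrder ι]
    {d : ι → ℕ} (M : ∀ i, Matrix (Fin (d i)) (Fin (d i)) R) :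
    (Matrix.blockDiagonal' M).charpoly = ∏ i, (M i).charpoly := by
  have h1 : (Matrix.blockDiagonal' M).charmatrix.BlockTriangular Sigma.fst := by
    rintro ⟨i, x⟩ ⟨j, y⟩ hij
    have hij' : i ≠ j := (ne_of_lt hij).symm
    rw [Matrix.charmatrix_apply_ne _ _ _ (fun h => hij' (congrArg Sigma.fst h)),
      Matrix.blockDiagonal'_apply_ne _ _ _ hij']
    simp
  rw [Matrix.charpoly, h1.det_fintype]
  refine Finset.prod_congr rfl fun i _ => ?_
  rw [Matrix.charpoly, ← Matrix.det_reindex_self (Equiv.sigmaSubtype i)]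
  congr 1
  ext1 x y
  rw [Matrix.reindex_apply, Matrix.submatrix_apply]
  change (Matrix.blockDiagonal' M).charmatrix ⟨i, x⟩ ⟨i, y⟩ = _
  by_cases hxy : x = y
  · subst hxy
    rw [Matrix.charmatrix_apply_eq, Matrix.charmatrix_apply_eq, Matrix.blockDiagonal'_apply_eq]
  · rw [Matrix.charmatrix_apply_ne _ _ _ (fun h => hxy (by simpa using h)),
      Matrix.charmatrix_apply_ne _ _ _ hxy, Matrix.blockDiagonal'_apply_eq]

section Assignment

variable {k V : Type*} [Field k] [AddCommGroup V] [Module k V] [FiniteDimensional k V]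

theorem IsCyclicSum.charpoly_eq_prod {ι : Type*} [Fintype ι] [LinearOrder ι] {T : Module.End k V}
    {f : ι → k[X]} (h : IsCyclicSum T f) (hf : ∀ i, (f i).Monic) :
    LinearMap.charpoly T = ∏ i, f i := by
  choose b hb using fun i => AdjoinRoot.exists_basis_toMatrix_companionMatrix (hf i) rfl
  obtain ⟨c, hc⟩ := h.exists_basis b
  rw [← LinearMap.charpoly_toMatrix T c, hc, Matrix.charpoly_blockDiagonal']
  exact Finset.prod_congr rfl fun i _ => by rw [hb, charpoly_companionMatrix (hf i) rfl]

/-- A direct sum of `m` cyclic modules can be given any characteristic polynomial by a perturbation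
of rank at most `m`. -/
theorem IsCyclicSum.exists_charpoly_add_eq {m : ℕ} {T : Module.End k V} {f : Fin m → k[X]}
    (h : IsCyclicSum T f) (hf : ∀ i, (f i).Monic) {r : k[X]} (hr : r.Monic)
    (hd : r.natDegree = ∑ i, (f i).natDegree) :
    ∃ B : Module.End k V, Module.finrank k (LinearMap.range B) ≤ m ∧
      LinearMap.charpoly (T + B) = r := by
  choose b hb using fun i => AdjoinRoot.exists_basis_toMatrix_companionMatrix (hf i) rfl
  obtain ⟨c, hc⟩ := h.exists_basis b
  simp only [hb] at hc
  set D := ∑ i, (f i).natDegree with hD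
  let c' := c.reindex finSigmaFinEquiv
  -- On the concatenated basis `R` shifts every vector but the very last, while `T` shifts every
  -- vector not last in its block; so they can differ only on block ends.
  let R : Module.End k V := Matrix.toLin c' c' (companionMatrix D r)
  have hc' : ∀ x, c' (finSigmaFinEquiv x) = c x := fun x => by simp [c']
  -- The difference on the last vector of each block; blocks of degree `0` have none and contribute
  -- `0`.
  let w : Fin m → V := fun i =>
    if hi : 0 < (f i).natDegree then (R - T) (c ⟨i, ⟨(f i).natDegree - 1, by omega⟩⟩) else 0
  refine ⟨R - T, ?_, ?_⟩
  · have hle : LinearMap.range (R - T) ≤ Submodule.span k (Set.range w) := by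
      rw [LinearMap.range_eq_map, ← c.span_eq, Submodule.map_span, Submodule.span_le]
      rintro _ ⟨_, ⟨⟨i, x⟩, rfl⟩, rfl⟩
      by_cases hx : (x : ℕ) + 1 = (f i).natDegree
      · have hi : 0 < (f i).natDegree := by omega
        refine Submodule.subset_span ⟨i, ?_⟩
        simp only [w]
        rw [dif_pos hi]
        congr 3
        ext
        simp only
        omega
      · have hx' : (x : ℕ) + 1 < (f i).natDegree := by omega
        let x' : Fin (f i).natDegree := ⟨x + 1, hx'⟩
        have hT : T (c ⟨i, x⟩) = c ⟨i, x'⟩ := by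
          rw [← Matrix.toLin_toMatrix c c T, Matrix.toLin_self, hc, Finset.sum_eq_single ⟨i, x'⟩]
          · rw [Matrix.blockDiagonal'_apply_eq]
            simp [companionMatrix, hx, x']
          · rintro ⟨j, y⟩ _ hne
            by_cases hij : j = i
            · subst hij
              rw [Matrix.blockDiagonal'_apply_eq]
              have : (y : ℕ) ≠ x + 1 := fun hy => hne (by rw [show y = x' from Fin.ext hy])
              simp [companionMatrix, hx, this]
            · rw [Matrix.blockDiagonal'_apply_ne _ _ _ hij, zero_smul]
          · simp
        have hnum : (finSigmaFinEquiv (⟨i, x'⟩ : Σ i, Fin (f i).natDegree) : ℕ) =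
            finSigmaFinEquiv (⟨i, x⟩ : Σ i, Fin (f i).natDegree) + 1 := by
          rw [finSigmaFinEquiv_apply, finSigmaFinEquiv_apply]
          simp only [x']
          omega
        have hR : R (c ⟨i, x⟩) = c ⟨i, x'⟩ := by
          rw [← hc', ← hc']
          have hlt := (finSigmaFinEquiv (⟨i, x'⟩ : Σ i, Fin (f i).natDegree)).2
          set u := finSigmaFinEquiv (⟨i, x⟩ : Σ i, Fin (f i).natDegree)
          set u' := finSigmaFinEquiv (⟨i, x'⟩ : Σ i, Fin (f i).natDegree)
          have hu : ¬ (u : ℕ) + 1 = D := by omega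
          rw [Matrix.toLin_self, Finset.sum_eq_single u']
          · simp [companionMatrix, hu, hnum]
          · intro y _ hy
            have : (y : ℕ) ≠ u + 1 := fun h => hy (Fin.ext (h.trans hnum.symm))
            simp [companionMatrix, hu, this]
          · simp
        rw [LinearMap.sub_apply, hT, hR, sub_self]
        exact Submodule.zero_mem _
    refine (Submodule.finrank_mono hle).trans ((finrank_range_le_card w).trans ?_)
    rw [Fintype.card_fin]
  · rw [add_sub_cancel, Matrix.charpoly_toLin, charpoly_companionMatrix hr hd]

/-- Only the summand built from `f` is perturbed; extending the perturbation by zero on the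
complement keeps its rank bound and the factor `∏ i, g i`. -/
theorem IsCyclicSum.exists_charpoly_add_eq_mul {m N : ℕ} {T : Module.End k V} {f : Fin m → k[X]}
    {g : Fin N → k[X]} (h : IsCyclicSum T (Sum.elim f g)) (hf : ∀ i, (f i).Monic)
    (hg : ∀ i, (g i).Monic) {r : k[X]} (hr : r.Monic)
    (hd : r.natDegree = ∑ i, (f i).natDegree) :
    ∃ B : Module.End k V, Module.finrank k (LinearMap.range B) ≤ m ∧
      LinearMap.charpoly (T + B) = r * ∏ i, g i := by
  obtain ⟨e, he⟩ := h
  have : ∀ i, Module.Finite k (AdjoinRoot (f i)) := fun i => (hf i).finite_adjoinRoot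
  have : ∀ i, Module.Finite k (AdjoinRoot (g i)) := fun i => (hg i).finite_adjoinRoot
  let E : V ≃ₗ[k] (∀ i, AdjoinRoot (f i)) × (∀ i, AdjoinRoot (g i)) :=
    e.trans (LinearEquiv.sumPiEquivProdPi k _ _ fun x => AdjoinRoot (Sum.elim f g x))
  let S : Module.End k (∀ i, AdjoinRoot (f i)) :=
    LinearMap.pi fun i => (Algebra.lmul k _ (AdjoinRoot.root (f i))).comp (LinearMap.proj i)
  let S' : Module.End k (∀ i, AdjoinRoot (g i)) :=
    LinearMap.pi fun i => (Algebra.lmul k _ (AdjoinRoot.root (g i))).comp (LinearMap.proj i)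
  have hS : IsCyclicSum S f := ⟨LinearEquiv.refl k _, fun v i => rfl⟩
  have hS' : IsCyclicSum S' g := ⟨LinearEquiv.refl k _, fun v i => rfl⟩
  have hE : ∀ v, E (T v) = S.prodMap S' (E v) := fun v =>
    Prod.ext (funext fun i => he v (Sum.inl i)) (funext fun i => he v (Sum.inr i))
  obtain ⟨B, hB, hB'⟩ := hS.exists_charpoly_add_eq hf hr hd
  let L : _ →ₗ[k] V := E.symm.toLinearMap ∘ₗ LinearMap.inl k _ _
  let B' : Module.End k V := L ∘ₗ B ∘ₗ LinearMap.fst k _ _ ∘ₗ E.toLinearMap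
  refine ⟨B', ?_, ?_⟩
  · refine le_trans ?_ hB
    refine (Submodule.finrank_mono ?_).trans (Submodule.finrank_map_le L (LinearMap.range B))
    rintro _ ⟨v, rfl⟩
    exact ⟨_, ⟨_, rfl⟩, rfl⟩
  · have hconj : E.conj (T + B') = (S + B).prodMap S' := by
      refine LinearMap.ext fun v => ?_
      rw [LinearEquiv.conj_apply_apply, LinearMap.add_apply, map_add, hE,
        LinearEquiv.apply_symm_apply]
      simp [B', L]
    rw [← E.charpoly_conj, hconj, LinearMap.charpoly_prodMap, hB', hS'.charpoly_eq_prod hg]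

end Assignment

/-! ### Multiplicities over the extension field. -/

section ZeroMultiplicity

variable {F K : Type*} [Field F] [Field K] [Algebra F K] {n : ℕ}

theorem zeroMultiplicity_prod {ι : Type*} (a : K) (s : Finset ι) (f : ι → F[X])
    (hf : ∀ i ∈ s, f i ≠ 0) :
    zeroMultiplicity a (∏ i ∈ s, f i) = ∑ i ∈ s, zeroMultiplicity a (f i) := by
  classical
  induction s using Finset.induction_on with
  | empty => simp [zeroMultiplicity, rootMultiplicity_eq_zero]
  | insert i s hi ih =>
    rw [Finset.prod_insert hi, Finset.sum_insert hi,
      ← ih fun j hj => hf j (Finset.mem_insert_of_mem hj)]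
    rw [zeroMultiplicity, Polynomial.map_mul, rootMultiplicity_mul]
    · rfl
    · rw [← Polynomial.map_mul, Polynomial.map_ne_zero_iff (algebraMap F K).injective]
      rw [← Finset.prod_insert hi]
      exact Finset.prod_ne_zero_iff.2 hf

theorem zeroMultiplicity_pow (a : K) {p : F[X]} (hp : p ≠ 0) (e : ℕ) :
    zeroMultiplicity a (p ^ e) = e * zeroMultiplicity a p := by
  have h := zeroMultiplicity_prod a (Finset.range e) (fun _ => p) fun _ _ => hp
  simpa using h

/-- Algebraic multiplicity is the dimension of the maximal generalized eigenspace, which is already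
attained at exponent `n`, the dimension of the space. -/
theorem zeroMultiplicity_charpoly (a : K) (M : Matrix (Fin n) (Fin n) F) :
    zeroMultiplicity a M.charpoly = Module.finrank K (LinearMap.ker
      ((Matrix.toLin' (M.map (algebraMap F K)) - algebraMap K _ a) ^ n)) := by
  rw [zeroMultiplicity, ← Matrix.charpoly_map, ← Matrix.charpoly_toLin',
    ← LinearMap.finrank_maxGenEigenspace_eq, Module.End.maxGenEigenspace_eq_genEigenspace_finrank,
    Module.finrank_fin_fun]
  have h : (Module.End.genEigenspace (Matrix.toLin' (M.map (algebraMap F K))) a) n =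
      LinearMap.ker ((Matrix.toLin' (M.map (algebraMap F K)) - algebraMap K _ a) ^ n) := by
    ext1 v
    rw [Module.End.mem_genEigenspace_nat, Algebra.algebraMap_eq_smul_one]
  rw [h]

theorem dvd_of_zeroMultiplicity_le [IsAlgClosed K] {p q : F[X]} (hp : p ≠ 0) (hq : q ≠ 0)
    (h : ∀ a : K, zeroMultiplicity a p ≤ zeroMultiplicity a q) : p ∣ q := by
  classical
  have inj := (algebraMap F K).injective
  rw [← Polynomial.map_dvd_map' (algebraMap F K), IsAlgClosed.dvd_iff_roots_le_roots
    ((Polynomial.map_ne_zero_iff inj).2 hp) ((Polynomial.map_ne_zero_iff inj).2 hq),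
    Multiset.le_iff_count]
  intro a
  rw [count_roots, count_roots]
  exact h a

theorem zeroMultiplicity_charpoly_eq_zero {a : K} {A : Matrix (Fin n) (Fin n) F}
    (h : ¬ IsEigenvalueOf a A) : zeroMultiplicity a A.charpoly = 0 := by
  rw [IsEigenvalueOf, Module.End.hasEigenvalue_iff_isRoot_charpoly, Matrix.charpoly_toLin',
    Matrix.charpoly_map] at h
  exact rootMultiplicity_eq_zero h

/-- `B` factors through its range, and the factorization, of inner size `B.rank`, survives extension
of scalars. -/
theorem Matrix.rank_map_algebraMap_le (B : Matrix (Fin n) (Fin n) F) :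
    (B.map (algebraMap F K)).rank ≤ B.rank := by
  classical
  set T := Matrix.toLin' B with hT
  have hr : B.rank = Module.finrank F (LinearMap.range T) := by
    rw [Matrix.rank, hT]; rfl
  let b := Module.finBasis F (LinearMap.range T)
  let s := Pi.basisFun F (Fin n)
  have h : B = LinearMap.toMatrix b s (LinearMap.range T).subtype *
      LinearMap.toMatrix s b T.rangeRestrict := by
    rw [← LinearMap.toMatrix_comp, LinearMap.subtype_comp_codRestrict,
      LinearMap.toMatrix_eq_toMatrix', hT, LinearMap.toMatrix'_toLin']
  rw [h, Matrix.map_mul]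
  refine (Matrix.rank_mul_le_left _ _).trans ((Matrix.rank_le_width _).trans ?_)
  rw [← h, hr]

end ZeroMultiplicity

/-! ### Selecting the first occurrences of each label. -/

section Position

variable {N : ℕ} {α : Type*} [DecidableEq α]

/-- The number of earlier indices with the same label. -/
def labelPosition (p : Fin N → α) (i : Fin N) : ℕ :=
  (Finset.univ.filter fun j => j < i ∧ p j = p i).card

theorem labelPosition_lt {p : Fin N → α} {i j : Fin N} (hij : i < j) (h : p i = p j) :
    labelPosition p i < labelPosition p j := by
  refine Finset.card_lt_card ?_
  rw [Finset.ssubset_iff]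
  refine ⟨i, by simp, ?_⟩
  intro x hx
  simp only [Finset.mem_insert, Finset.mem_filter, Finset.mem_univ, true_and] at hx ⊢
  rcases hx with rfl | ⟨h1, h2⟩
  · exact ⟨hij, h⟩
  · exact ⟨h1.trans hij, h2.trans h⟩

theorem labelPosition_injOn {p : Fin N → α} {i j : Fin N} (h : p i = p j)
    (h' : labelPosition p i = labelPosition p j) : i = j := by
  rcases lt_trichotomy i j with hij | hij | hij
  · exact absurd h' (labelPosition_lt hij h).ne
  · exact hij
  · exact absurd h' (labelPosition_lt hij h.symm).ne'

theorem min_card_le_card_filter_labelPosition_lt {p : Fin N → α} {s : Finset (Fin N)}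
    (hs : ∀ i ∈ s, ∀ j, j < i → p j = p i → j ∈ s) (m : ℕ) :
    min m s.card ≤ (s.filter fun i => labelPosition p i < m).card := by
  by_cases h : ∃ i ∈ s, m ≤ labelPosition p i
  -- For the minimal such `i`, its at least `m` predecessors with the same label lie in `s`, and by
  -- minimality all have position below `m`.
  · obtain ⟨i, hi, hmin⟩ := (s.filter fun i => m ≤ labelPosition p i).exists_minimal
      (by obtain ⟨i, hi, hi'⟩ := h; exact ⟨i, Finset.mem_filter.2 ⟨hi, hi'⟩⟩)
    rw [Finset.mem_filter] at hi
    refine (min_le_left _ _).trans (hi.2.trans (Finset.card_le_card ?_))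
    intro j hj
    simp only [Finset.mem_filter, Finset.mem_univ, true_and] at hj
    have hjs := hs i hi.1 j hj.1 hj.2
    rw [Finset.mem_filter]
    refine ⟨hjs, ?_⟩
    by_contra hc
    have := hmin (Finset.mem_filter.2 ⟨hjs, not_lt.1 hc⟩) hj.1.le
    exact absurd hj.1 (not_lt.2 this)
  · push Not at h
    rw [Finset.filter_true_of_mem h]
    exact min_le_right _ _

end Position

/-! ### The two implications. -/

section RankPerturbation

variable {F K : Type*} [Field F] [Field K] [Algebra F K] {n : ℕ}

theorem JordanBlocks.algMultiplicity_le_add_sum_nthSize {J : JordanBlocks K}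
    {A : Matrix (Fin n) (Fin n) F} (hJ : J.IsJordanFormOf A) (B : Matrix (Fin n) (Fin n) F) (a : K) :
    algMultiplicity a A ≤
      zeroMultiplicity a (A + B).charpoly + ∑ j ∈ Finset.range B.rank, J.nthSize a j := by
  have hB : Module.finrank K (LinearMap.range (Matrix.toLin' (B.map (algebraMap F K)))) ≤
      B.rank := B.rank_map_algebraMap_le
  have h := LinearMap.finrank_ker_pow_le_add
    (Matrix.toLin' (A.map (algebraMap F K)) - algebraMap K _ a) _ hB n
  rw [← JordanBlocks.sum_nthSize hJ, ← zeroMultiplicity_charpoly, sub_add_eq_add_sub, ← map_add,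
    ← Matrix.map_add _ (map_add _), ← zeroMultiplicity_charpoly] at h
  exact h

/-- The `m` top exponents of each prime, in a decomposition over the ground field, account for the
`m` largest Jordan blocks for `a`. -/
theorem JordanBlocks.sum_nthSize_le_sum_zeroMultiplicity [DecidableEq F[X]] {J : JordanBlocks K}
    {A : Matrix (Fin n) (Fin n) F} (hJ : J.IsJordanFormOf A) {N : ℕ} {p : Fin N → F[X]}
    {e : Fin N → ℕ} (hm : ∀ i, (p i).Monic) (he : Antitone e)
    (hA : IsCyclicSum (Matrix.toLin' A) fun i => p i ^ e i) (a : K) (m : ℕ) :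
    ∑ j ∈ Finset.range m, J.nthSize a j ≤
      ∑ i with labelPosition p i < m, zeroMultiplicity a (p i ^ e i) := by
  have hA' := hA.map (K := K) fun i => (hm i).pow (e i)
  have h1 : ∀ t, Module.finrank K (LinearMap.ker
        ((Matrix.toLin' (A.map (algebraMap F K)) - algebraMap K _ a) ^ (t + 1))) -
      Module.finrank K (LinearMap.ker
        ((Matrix.toLin' (A.map (algebraMap F K)) - algebraMap K _ a) ^ t)) =
      (Finset.univ.filter fun i => t < zeroMultiplicity a (p i ^ e i)).card :=
    hA'.card_lt_rootMultiplicity (fun i => (((hm i).pow (e i)).map _).ne_zero) a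
  rw [JordanBlocks.sum_nthSize hJ]
  simp only [h1]
  have h2 : ∀ t, min m (Finset.univ.filter fun i => t < zeroMultiplicity a (p i ^ e i)).card ≤
      ∑ i with labelPosition p i < m, if t < zeroMultiplicity a (p i ^ e i) then 1 else 0 := by
    intro t
    refine (min_card_le_card_filter_labelPosition_lt (p := p) ?_ m).trans ?_
    -- An earlier occurrence of the same prime has at least as large an exponent, so it also has
    -- multiplicity greater than `t`.
    · intro i hi j hji hp
      simp only [Finset.mem_filter, Finset.mem_univ, true_and] at hi ⊢
      rw [zeroMultiplicity_pow _ (hm _).ne_zero] at hi ⊢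
      rw [hp]
      exact hi.trans_le (Nat.mul_le_mul_right _ (he hji.le))
    · rw [← Finset.card_filter, Finset.filter_filter, Finset.filter_filter]
      exact (congrArg Finset.card (Finset.filter_congr fun i _ => and_comm)).le
  refine (Finset.sum_le_sum fun t _ => h2 t).trans ?_
  rw [Finset.sum_comm]
  refine Finset.sum_le_sum fun i _ => ?_
  rw [← Finset.card_filter]
  refine (Finset.card_le_card (t := Finset.range (zeroMultiplicity a (p i ^ e i))) ?_).trans
    (Finset.card_range _).le
  intro t ht
  exact Finset.mem_range.2 (Finset.mem_filter.1 ht).2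

theorem exists_rank_le_charpoly_add_eq [IsAlgClosed K] {m : ℕ} {A : Matrix (Fin n) (Fin n) F}
    {q : F[X]} (hq : q.Monic) (hdeg : q.natDegree = n) {J : JordanBlocks K}
    (hJ : J.IsJordanFormOf A)
    (h : ∀ a : K, IsEigenvalueOf a A → algMultiplicity a A ≤
      zeroMultiplicity a q + ∑ j ∈ Finset.range m, J.nthSize a j) :
    ∃ B : Matrix (Fin n) (Fin n) F, B.rank ≤ m ∧ (A + B).charpoly = q := by
  classical
  obtain ⟨N, p, e, hm, hirr, he, hA⟩ := exists_isCyclicSum_irreducible_pow (Matrix.toLin' A)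
  have hfm : ∀ i, (p i ^ e i).Monic := fun i => (hm i).pow (e i)
  -- Pieces at the same position `< m` are merged: their primes are distinct, hence coprime. Every
  -- other piece stays alone, and an unused label gets the empty product `1`.
  let c : Fin N → Fin m ⊕ Fin N := fun i =>
    if hi : labelPosition p i < m then Sum.inl ⟨labelPosition p i, hi⟩ else Sum.inr i
  have hc : ∀ i j, i ≠ j → c i = c j → IsCoprime (p i ^ e i) (p j ^ e j) := by
    intro i j hij hcij
    apply IsCoprime.pow
    rw [(hirr i).coprime_iff_not_dvd]
    intro hd
    have hp := eq_of_monic_of_associated (hm i) (hm j) ((hirr i).associated_of_dvd (hirr j) hd)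
    simp only [c] at hcij
    split_ifs at hcij with h1 h2
    · simp only [Sum.inl.injEq, Fin.mk.injEq] at hcij
      exact hij (labelPosition_injOn hp hcij)
    · exact hij (Sum.inr_injective hcij)
  have hG := hA.prod_fiber hfm c hc
  set G : Fin m ⊕ Fin N → F[X] := fun x => ∏ i with c i = x, p i ^ e i with hGdef
  have hGm : ∀ x, (G x).Monic := fun x => monic_prod_of_monic _ _ fun i _ => hfm i
  have hGdeg : n = ∑ j, (G (Sum.inl j)).natDegree + ∑ j, (G (Sum.inr j)).natDegree := by
    obtain ⟨E, -⟩ := hG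
    have h1 := E.finrank_eq
    have : ∀ x, Module.Finite F (AdjoinRoot (G x)) := fun x => (hGm x).finite_adjoinRoot
    rw [Module.finrank_fin_fun, Module.finrank_pi_fintype, Fintype.sum_sum_type] at h1
    simpa only [AdjoinRoot.finrank_eq_natDegree (hGm _)] using h1
  set H := ∏ j, G (Sum.inr j) with hH
  have hHm : H.Monic := monic_prod_of_monic _ _ fun j _ => hGm _
  have hHeq : H = ∏ i with ¬ labelPosition p i < m, p i ^ e i := by
    rw [hH, Finset.prod_filter]
    refine Finset.prod_congr rfl fun j _ => ?_
    rw [hGdef]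
    simp only
    by_cases hj : labelPosition p j < m
    · rw [if_neg (not_not.2 hj)]
      apply Finset.prod_eq_one
      intro i hi
      simp only [Finset.mem_filter, Finset.mem_univ, true_and, c] at hi
      split_ifs at hi with h1
      rw [Sum.inr_injective hi] at h1
      exact absurd hj h1
    · rw [if_pos hj, Finset.prod_eq_single j]
      · intro i hi hij
        simp only [Finset.mem_filter, Finset.mem_univ, true_and, c] at hi
        split_ifs at hi with h1
        exact absurd (Sum.inr_injective hi) hij
      · intro hj'
        simp [c, hj] at hj'
  have hcharpoly : A.charpoly = ∏ i, p i ^ e i := by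
    rw [← Matrix.charpoly_toLin', hA.charpoly_eq_prod hfm]
  -- At an eigenvalue, the selected pieces account for at least the `m` largest blocks, so what is
  -- left in `H` is at most the multiplicity in `q`; elsewhere `H` has no zero.
  have hdvd : H ∣ q := by
    refine dvd_of_zeroMultiplicity_le (K := K) hHm.ne_zero hq.ne_zero fun a => ?_
    have h1 : zeroMultiplicity a A.charpoly =
        ∑ i with labelPosition p i < m, zeroMultiplicity a (p i ^ e i) + zeroMultiplicity a H := by
      rw [hcharpoly, hHeq, zeroMultiplicity_prod _ _ _ fun i _ => (hfm i).ne_zero,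
        zeroMultiplicity_prod _ _ _ fun i _ => (hfm i).ne_zero,
        Finset.sum_filter_add_sum_filter_not]
    by_cases ha : IsEigenvalueOf a A
    · have h2 := h a ha
      have h3 := JordanBlocks.sum_nthSize_le_sum_zeroMultiplicity hJ hm he hA a m
      rw [algMultiplicity] at h2
      omega
    · rw [zeroMultiplicity_charpoly_eq_zero ha] at h1
      omega
  obtain ⟨r, hr⟩ := hdvd
  have hrm : r.Monic := hHm.of_mul_monic_left (hr ▸ hq)
  -- Here `deg q = n` is needed: `r` must fit the dimension of the merged summands.
  have hrdeg : r.natDegree = ∑ j, (G (Sum.inl j)).natDegree := by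
    have h1 := hHm.natDegree_mul hrm
    rw [← hr, hdeg, hH, natDegree_prod_of_monic _ _ fun j _ => hGm _] at h1
    omega
  have hG' : IsCyclicSum (Matrix.toLin' A) (Sum.elim (fun j => G (Sum.inl j))
      (fun j => G (Sum.inr j))) := by
    have : Sum.elim (fun j => G (Sum.inl j)) (fun j => G (Sum.inr j)) = G := by
      funext x
      cases x <;> rfl
    rwa [this]
  obtain ⟨B, hB, hB'⟩ := hG'.exists_charpoly_add_eq_mul (fun j => hGm _) (fun j => hGm _) hrm hrdeg
  refine ⟨LinearMap.toMatrix' B, ?_, ?_⟩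
  · rw [Matrix.rank, ← Matrix.toLin'_apply', Matrix.toLin'_toMatrix']
    exact hB
  · rw [← Matrix.charpoly_toLin', map_add, Matrix.toLin'_toMatrix', hB', hr, mul_comm]

end RankPerturbation

end

theorem mainTheorem1 {F : Type*} [Field F] {K : Type*} [Field K] [Algebra F K] [IsAlgClosure F K]
    (n m : ℕ) (A : Matrix (Fin n) (Fin n) F) (q : F[X]) (hq : q.Monic) (hdeg : q.natDegree = n) :
    (∃ J : JordanBlocks K, J.IsJordanFormOf A) ∧
    ∀ J : JordanBlocks K, J.IsJordanFormOf A →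
      ((∃ B : Matrix (Fin n) (Fin n) F, B.rank ≤ m ∧ (A + B).charpoly = q) ↔
        ∀ a : K, IsEigenvalueOf a A →
          (algMultiplicity a A : ℤ) - ∑ j ∈ Finset.range m, (J.nthSize a j : ℤ)
            ≤ (zeroMultiplicity a q : ℤ)) := by
  have : IsAlgClosed K := IsAlgClosure.isAlgClosed F
  refine ⟨JordanBlocks.exists_isJordanFormOf A, fun J hJ => ?_⟩
  have hcast : ∀ a : K, ((algMultiplicity a A : ℤ) - ∑ j ∈ Finset.range m, (J.nthSize a j : ℤ)
      ≤ (zeroMultiplicity a q : ℤ)) ↔ algMultiplicity a A ≤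
        zeroMultiplicity a q + ∑ j ∈ Finset.range m, J.nthSize a j := fun a => by
    rw [sub_le_iff_le_add]
    exact_mod_cast Iff.rfl
  simp only [hcast]
  constructor
  · rintro ⟨B, hB, rfl⟩ a -
    -- The bound holds with `B.rank` blocks, and adding further blocks up to `m` only weakens it.
    exact (JordanBlocks.algMultiplicity_le_add_sum_nthSize hJ B a).trans
      (Nat.add_le_add_left (Finset.sum_le_sum_of_subset (Finset.range_mono hB)) _)
  · exact exists_rank_le_charpoly_add_eq hq hdeg hJ
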